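/- **Theorem 4.2 (Berger–Joyal duality).** For every integer $n\ge 1$ there is an equivalence of categories $$\Theta_n^{\mathrm{op}}\simeq\mathcal D_n,$$ where $\Theta_n$ is Berger's category and $\mathcal D_n$ is Joyal's category of finite combinatorial $n$-disks, defined as follows. *Berger's category.* $\Delta$ is the simplex category, with objects $[m]=\{0<1<\dots<m\}$, $m\ge 0$, and order-preserving maps. $\Gamma$ is Segal's category: its objects are the sets $\underline m=\{1,\dots,m\}$, $m\ge 0$. A morphism $f:\underline m\to\underline l$ is a function assigning to each $a\in\underline m$ a subset $f(a)\subseteq\underline l$ such that $f(a)\cap f(b)=\emptyset$ for $a\ne b$; composition is $(gf)(a)=\bigcup_{b\in f(a)}g(b)$, and the identity is $a\mapsto\{a\}$. The Segal map $\gamma:\Delta\to\Gamma$ sends $[m]$ to its set of edges $e_i:i-1\to i$ $(1\le i\le m)$, identified with $\underline m$. For $f:[m]\to[l]$, it sets $\gamma(f)(e_i)=\{e_j : f(i-1)\le j-1 \text{ and } j\le f(i)\}$, the set of edges of $[l]$ whose composite is $f(i-1)\to f(i)$. For a category $A$, the wreath product $\Delta\wr A$ has as objects the pairs $([m],a)$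 with $a:\gamma([m])\to\mathrm{Ob}(A)$ a function. A morphism $([m],a)\to([l],b)$ is a morphism $f_0:[m]\to[l]$ of $\Delta$ together with a morphism $f_{ji}:a(i)\to b(j)$ of $A$ for each $i\in\gamma([m])$ and $j\in\gamma(f_0)(i)$. Composition is given by $(gf)_0=g_0f_0$ and $(gf)_{ki}=g_{kj}f_{ji}$, where $j\in\gamma(f_0)(i)$ is the unique element with $k\in\gamma(g_0)(j)$. The identity of $([m],a)$ consists of identities. Then $\Theta_1:=\Delta$ and $\Theta_n:=\Delta\wr\Theta_{n-1}$ for $n>1$. *Disks.* An object $X$ of $\mathcal D_n$ consists of sets $X_0,\dots,X_n$, maps $s_k,t_k:X_k\to X_{k+1}$ and $p_{k+1}:X_{k+1}\to X_k$ for $0\le k<n$, and a linear order on each fibre $p_{k+1}^{-1}(x)$, $x\in X_k$, $0\le k<n$. These satisfy $p_ks_{k-1}=1=p_kt_{k-1}$ for $1\le k\le n$, and $s_ks_{k-1}=t_ks_{k-1}$, $s_kt_{k-1}=t_kt_{k-1}$ for $1\le k<n$, and moreover: 1. $X_0=\{*\}$ is a one-element set and $s_0(*)\neq t_0(*)$;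 2. $\{x\in X_k : s_k(x)=t_k(x)\}=s_{k-1}(X_{k-1})\cup t_{k-1}(X_{k-1})$ for $1\le k<n$; 3. for $0\le k<n$ and $x\in X_k$, the linearly ordered set $p_{k+1}^{-1}(x)$ is finite, with minimum $s_k(x)$ and maximum $t_k(x)$. A morphism $f:X\to Y$ in $\mathcal D_n$ is a family of maps $f_k:X_k\to Y_k$, $0\le k\le n$, commuting with all $s_k,t_k,p_k$ and weakly order-preserving on each fibre of each $p_{k+1}$; composition is componentwise. -/

import Mathlib

open CategoryTheory

universe u v w z

namespace BergerJoyal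

/-- Segal's category `Γ` in its skeletal description: the object `⟨n⟩` stands for the finite set
`{1, …, n}`, modelled by `Fin n`. -/
structure Gam : Type where
  /-- the number of elements -/
  card : ℕ

namespace Gam

/-- A map `m → l` in `Γ`: a function from `Fin m` to the subsets of `Fin l` carrying distinct
elements to disjoint subsets. -/
@[ext]
structure Hom (A B : Gam) : Type where
  /-- the subset-valued function -/
  fn : Fin A.card → Set (Fin B.card)
  disj : ∀ a b, a ≠ b → Disjoint (fn a) (fn b)

theorem Hom.eq_of_mem {A B : Gam} (f : Hom A B) {a b : Fin A.card} {c : Fin B.card}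
    (ha : c ∈ f.fn a) (hb : c ∈ f.fn b) : a = b := by
  by_contra hne
  exact Set.disjoint_left.1 (f.disj a b hne) ha hb

/-- Identities are `a ↦ {a}`, and the composite of `f` and `g` is `a ↦ ⋃ b ∈ f a, g b`. -/
instance : Category Gam where
  Hom := Hom
  id A :=
    { fn := fun a => {a}
      disj := fun a b hab => by simpa using hab }
  comp f g :=
    { fn := fun a => ⋃ b ∈ f.fn a, g.fn b
      disj := fun a b hab => by
        rw [Set.disjoint_left]
        intro x hx hx'
        simp only [Set.mem_iUnion, exists_prop] at hx hx'
        obtain ⟨c, hc, hxc⟩ := hx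
        obtain ⟨d, hd, hxd⟩ := hx'
        obtain rfl := g.eq_of_mem hxc hxd
        exact hab (f.eq_of_mem hc hd) }
  id_comp f := by
    apply Hom.ext; funext a; ext x; simp
  comp_id f := by
    apply Hom.ext; funext a; ext x; simp
  assoc f g h := by
    apply Hom.ext; funext a; ext x
    simp only [Set.mem_iUnion, exists_prop]
    constructor
    · rintro ⟨c, ⟨b, hb, hc⟩, hx⟩
      exact ⟨b, hb, c, hc, hx⟩
    · rintro ⟨b, hb, c, hc, hx⟩
      exact ⟨c, ⟨b, hb, hc⟩, hx⟩

theorem mem_id {A : Gam} {a b : Fin A.card} : b ∈ Hom.fn (𝟙 A) a ↔ b = a := Iff.rfl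

theorem mem_comp {A B C : Gam} (f : A ⟶ B) (g : B ⟶ C) {a : Fin A.card} {c : Fin C.card} :
    c ∈ Hom.fn (f ≫ g) a ↔ ∃ b, b ∈ Hom.fn f a ∧ c ∈ Hom.fn g b := by
  change c ∈ ⋃ b ∈ Hom.fn f a, Hom.fn g b ↔ _
  simp

end Gam

/-- The Segal map `γ : Δ ⥤ Γ`. It sends `[n]` to its set of edges `e_i : i → i + 1`, `i : Fin n`,
and `γ(f)(e_i)` is the set of the edges `e_j` of the target that make up the map
`f(i) → f(i + 1)`, that is, those with `f(i) ≤ j` and `j + 1 ≤ f(i + 1)`. -/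
def segalMap : SimplexCategory ⥤ Gam where
  obj x := ⟨x.len⟩
  map {x y} f :=
    { fn := fun i => {j : Fin y.len |
        f.toOrderHom i.castSucc ≤ j.castSucc ∧ j.succ ≤ f.toOrderHom i.succ}
      disj := by
        have key : ∀ a b : Fin x.len, a < b → ∀ j : Fin y.len,
            j.succ ≤ f.toOrderHom a.succ → f.toOrderHom b.castSucc ≤ j.castSucc → False := by
          intro a b hab j h1 h2
          have h3 : f.toOrderHom a.succ ≤ f.toOrderHom b.castSucc :=
            f.toOrderHom.monotone (by rw [Fin.le_def]; simpa using hab)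
          have h4 := (h1.trans h3).trans h2
          rw [Fin.le_def] at h4
          simp at h4
        intro a b hab
        rw [Set.disjoint_left]
        rintro j ⟨h1, h2⟩ ⟨h3, h4⟩
        rcases lt_or_gt_of_ne hab with h | h
        · exact key a b h j h2 h3
        · exact key b a h j h4 h1 }
  map_id x := by
    apply Gam.Hom.ext; funext i; ext j
    refine Iff.trans ?_ Gam.mem_id.symm
    change (i.castSucc ≤ j.castSucc ∧ j.succ ≤ i.succ) ↔ j = i
    rw [Fin.castSucc_le_castSucc_iff, Fin.succ_le_succ_iff]
    exact ⟨fun h => le_antisymm h.2 h.1, fun h => ⟨h.ge, h.le⟩⟩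
  map_comp {x y z} f g := by
    apply Gam.Hom.ext; funext i; ext k
    refine Iff.trans ?_ (Gam.mem_comp _ _).symm
    change (g.toOrderHom (f.toOrderHom i.castSucc) ≤ k.castSucc ∧
        k.succ ≤ g.toOrderHom (f.toOrderHom i.succ)) ↔
      ∃ j : Fin y.len, (f.toOrderHom i.castSucc ≤ j.castSucc ∧ j.succ ≤ f.toOrderHom i.succ) ∧
        (g.toOrderHom j.castSucc ≤ k.castSucc ∧ k.succ ≤ g.toOrderHom j.succ)
    constructor
    · rintro ⟨h1, h2⟩
      have step : ∀ b : Fin (y.len + 1), k.succ ≤ g.toOrderHom b →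
          f.toOrderHom i.castSucc ≤ b → ∃ j : Fin y.len,
            (f.toOrderHom i.castSucc ≤ j.castSucc ∧ j.succ ≤ b) ∧
            (g.toOrderHom j.castSucc ≤ k.castSucc ∧ k.succ ≤ g.toOrderHom j.succ) := by
        intro b
        induction b using Fin.induction with
        | zero =>
          intro hb hle
          have h0 : f.toOrderHom i.castSucc = 0 := le_antisymm hle (Fin.zero_le _)
          rw [h0] at h1
          have := hb.trans h1
          rw [Fin.le_def] at this
          simp at this
        | succ j ih =>
          intro hb hle
          by_cases hj : g.toOrderHom j.castSucc ≤ k.castSucc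
          · refine ⟨j, ⟨?_, le_rfl⟩, hj, hb⟩
            by_contra hlt
            rw [not_le] at hlt
            have heq : f.toOrderHom i.castSucc = j.succ := by
              apply le_antisymm hle
              rw [Fin.le_def]
              rw [Fin.lt_def] at hlt
              simpa using hlt
            rw [heq] at h1
            have := hb.trans h1
            rw [Fin.le_def] at this
            simp at this
          · have hk : k.succ ≤ g.toOrderHom j.castSucc := by
              rw [not_le, Fin.lt_def] at hj
              rw [Fin.le_def]
              simpa using hj
            have hle' : f.toOrderHom i.castSucc ≤ j.castSucc := by
              by_contra hlt
              rw [not_le] at hlt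
              exact hj ((g.toOrderHom.monotone hlt.le).trans h1)
            obtain ⟨j', ⟨ha, hb'⟩, hc⟩ := ih hk hle'
            exact ⟨j', ⟨ha, hb'.trans (Fin.castSucc_lt_succ).le⟩, hc⟩
      exact step _ h2 (f.toOrderHom.monotone (Fin.castSucc_lt_succ).le)
    · rintro ⟨j, ⟨h1, h2⟩, h3, h4⟩
      exact ⟨(g.toOrderHom.monotone h1).trans h3, h4.trans (g.toOrderHom.monotone h2)⟩

/-- Objects of the wreath product `X ≀ A` along `γ : X ⥤ Γ`: an object `base` of `X` together with
a family of objects of `A` indexed by the finite set `γ(base)`. -/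
structure Wreath {X : Type u} [Category.{v} X] (γ : X ⥤ Gam) (A : Type w) [Category.{z} A] :
    Type (max u w) where
  /-- the object of `X` -/
  base : X
  /-- the labelling of `γ(base)` by objects of `A` -/
  label : Fin (γ.obj base).card → A

namespace Wreath

variable {X : Type u} [Category.{v} X] {γ : X ⥤ Gam} {A : Type w} [Category.{z} A]

/-- A morphism `(I, a) → (J, b)`: a morphism `f₀ : I → J` of `X` and, for each `i ∈ γ(I)` and
`j ∈ γ(f₀)(i)`, a morphism `a(i) → b(j)` of `A`. -/
structure Hom (P Q : Wreath γ A) : Type (max v z) where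
  /-- the morphism `f₀` -/
  base : P.base ⟶ Q.base
  /-- the morphisms `f_{ji}` -/
  app : ∀ (i : Fin (γ.obj P.base).card) (j : Fin (γ.obj Q.base).card),
    j ∈ Gam.Hom.fn (γ.map base) i → (P.label i ⟶ Q.label j)

theorem Hom.ext' {P Q : Wreath γ A} {f g : Hom P Q} (h : f.base = g.base)
    (h' : ∀ i j (hf : j ∈ Gam.Hom.fn (γ.map f.base) i) (hg : j ∈ Gam.Hom.fn (γ.map g.base) i),
      f.app i j hf = g.app i j hg) : f = g := by
  obtain ⟨f₀, f₁⟩ := f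
  obtain ⟨g₀, g₁⟩ := g
  obtain rfl : f₀ = g₀ := h
  congr 1
  funext i j hj
  exact h' i j hj hj

/-- The identity: `1_{ii}` is the identity of `a(i)`. -/
def Hom.id (P : Wreath γ A) : Hom P P where
  base := 𝟙 P.base
  app i j hj := eqToHom (congrArg P.label
    (Gam.mem_id.1 (by rw [γ.map_id] at hj; exact hj) : j = i).symm)

theorem exists_mid {P Q R : Wreath γ A} (f : Hom P Q) (g : Hom Q R)
    {i : Fin (γ.obj P.base).card} {k : Fin (γ.obj R.base).card}
    (hk : k ∈ Gam.Hom.fn (γ.map (f.base ≫ g.base)) i) :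
    ∃ j, j ∈ Gam.Hom.fn (γ.map f.base) i ∧ k ∈ Gam.Hom.fn (γ.map g.base) j := by
  rw [γ.map_comp] at hk
  exact (Gam.mem_comp _ _).1 hk

/-- The composite: `(gf)_{ki} = g_{kj} f_{ji}`, where `j ∈ γ(f₀)(i)` is the unique element with
`k ∈ γ(g₀)(j)`. -/
noncomputable def Hom.comp {P Q R : Wreath γ A} (f : Hom P Q) (g : Hom Q R) : Hom P R where
  base := f.base ≫ g.base
  app i k hk :=
    f.app i (exists_mid f g hk).choose (exists_mid f g hk).choose_spec.1 ≫
      g.app (exists_mid f g hk).choose k (exists_mid f g hk).choose_spec.2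

theorem Hom.comp_app {P Q R : Wreath γ A} (f : Hom P Q) (g : Hom Q R)
    {i : Fin (γ.obj P.base).card} {j : Fin (γ.obj Q.base).card} {k : Fin (γ.obj R.base).card}
    (hj : j ∈ Gam.Hom.fn (γ.map f.base) i) (hk : k ∈ Gam.Hom.fn (γ.map g.base) j)
    (h : k ∈ Gam.Hom.fn (γ.map (f.base ≫ g.base)) i) :
    (Hom.comp f g).app i k h = f.app i j hj ≫ g.app j k hk := by
  have key : ∀ (j' : Fin (γ.obj Q.base).card) (hj' : j' ∈ Gam.Hom.fn (γ.map f.base) i)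
      (hk' : k ∈ Gam.Hom.fn (γ.map g.base) j'),
      f.app i j' hj' ≫ g.app j' k hk' = f.app i j hj ≫ g.app j k hk := by
    intro j' hj' hk'
    obtain rfl := Gam.Hom.eq_of_mem _ hk hk'
    rfl
  exact key _ _ _

noncomputable instance : Category.{max v z} (Wreath γ A) where
  Hom := Hom
  id := Hom.id
  comp := Hom.comp
  id_comp {P Q} f := by
    refine Hom.ext' (Category.id_comp f.base) ?_
    intro i j hf hg
    have hi : i ∈ Gam.Hom.fn (γ.map (Hom.id P).base) i := by
      change i ∈ Gam.Hom.fn (γ.map (𝟙 _)) i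
      rw [γ.map_id]; exact Gam.mem_id.2 rfl
    refine (Hom.comp_app (Hom.id P) f hi hg hf).trans ?_
    simp [Hom.id]
  comp_id {P Q} f := by
    refine Hom.ext' (Category.comp_id f.base) ?_
    intro i j hf hg
    have hj : j ∈ Gam.Hom.fn (γ.map (Hom.id Q).base) j := by
      change j ∈ Gam.Hom.fn (γ.map (𝟙 _)) j
      rw [γ.map_id]; exact Gam.mem_id.2 rfl
    refine (Hom.comp_app f (Hom.id Q) hg hj hf).trans ?_
    simp [Hom.id]
  assoc {P Q R S} f g h := by
    refine Hom.ext' (Category.assoc f.base g.base h.base) ?_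
    intro i l hl hl'
    obtain ⟨k, hk, hkl⟩ := exists_mid (Hom.comp f g) h hl
    obtain ⟨j, hj, hjk⟩ := exists_mid f g hk
    have hjl : l ∈ Gam.Hom.fn (γ.map (Hom.comp g h).base) j := by
      change l ∈ Gam.Hom.fn (γ.map (g.base ≫ h.base)) j
      rw [γ.map_comp]; exact (Gam.mem_comp _ _).2 ⟨k, hjk, hkl⟩
    refine (Hom.comp_app (Hom.comp f g) h hk hkl hl).trans ?_
    rw [Hom.comp_app f g hj hjk hk]
    refine Eq.trans ?_ (Hom.comp_app f (Hom.comp g h) hj hjl hl').symm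
    rw [Hom.comp_app g h hjk hkl hjl, Category.assoc]

end Wreath

/-- Berger's categories: `Θ_1 = Δ` and `Θ_n = Δ ≀ Θ_{n-1}` for `n > 1`. The value at `0`, the
terminal category, is only a convention. -/
noncomputable def Theta : ℕ → Cat.{0, 0}
  | 0 => Cat.of (Discrete PUnit)
  | 1 => Cat.of SimplexCategory
  | n + 2 => Cat.of (Wreath segalMap (Theta (n + 1)))

/-- Finite combinatorial `n`-disks. The linear orders on the fibres of `p : X_{k+1} → X_k` are
encoded as one relation `le` on `X_{k+1}` under which only elements of the same fibre are
comparable. The map `p k` below is the one usually called `p_{k+1}`. -/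
structure Disk (n : ℕ) : Type (u + 1) where
  /-- the sets `X_0, …, X_n` -/
  X : (k : ℕ) → k ≤ n → Type u
  /-- the maps `s_k : X_k → X_{k+1}` -/
  s : (k : ℕ) → (h : k + 1 ≤ n) → X k (Nat.le_of_succ_le h) → X (k + 1) h
  /-- the maps `t_k : X_k → X_{k+1}` -/
  t : (k : ℕ) → (h : k + 1 ≤ n) → X k (Nat.le_of_succ_le h) → X (k + 1) h
  /-- the maps `p_{k+1} : X_{k+1} → X_k` -/
  p : (k : ℕ) → (h : k + 1 ≤ n) → X (k + 1) h → X k (Nat.le_of_succ_le h)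
  /-- the order of the fibres of `p_{k+1}` -/
  le : (k : ℕ) → (h : k + 1 ≤ n) → X (k + 1) h → X (k + 1) h → Prop
  p_s : ∀ k h x, p k h (s k h x) = x
  p_t : ∀ k h x, p k h (t k h x) = x
  s_s : ∀ (k : ℕ) (h : k + 2 ≤ n) (x : X k (Nat.le_of_add_right_le h)),
    s (k + 1) h (s k (Nat.le_of_succ_le h) x) = t (k + 1) h (s k (Nat.le_of_succ_le h) x)
  s_t : ∀ (k : ℕ) (h : k + 2 ≤ n) (x : X k (Nat.le_of_add_right_le h)),
    s (k + 1) h (t k (Nat.le_of_succ_le h) x) = t (k + 1) h (t k (Nat.le_of_succ_le h) x)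
  /-- `X_0` has exactly one element. -/
  existsUnique_zero : ∃! x : X 0 (Nat.zero_le n), x = x
  s_ne_t : ∀ (h : 1 ≤ n) (x : X 0 (Nat.zero_le n)), s 0 h x ≠ t 0 h x
  /-- The equalizer of `s_{k+1}` and `t_{k+1}` is the union of the images of `s_k` and `t_k`. -/
  equalizer_eq : ∀ (k : ℕ) (h : k + 2 ≤ n),
    {x | s (k + 1) h x = t (k + 1) h x} =
      Set.range (s k (Nat.le_of_succ_le h)) ∪ Set.range (t k (Nat.le_of_succ_le h))
  fibre_finite : ∀ k h x, {y | p k h y = x}.Finite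
  p_eq_of_le : ∀ k h y y', le k h y y' → p k h y = p k h y'
  le_refl : ∀ k h y, le k h y y
  le_trans : ∀ k h y y' y'', le k h y y' → le k h y' y'' → le k h y y''
  le_antisymm : ∀ k h y y', le k h y y' → le k h y' y → y = y'
  le_total : ∀ k h y y', p k h y = p k h y' → le k h y y' ∨ le k h y' y
  /-- `s_k(x)` is the minimum of the fibre over `x`. -/
  s_le : ∀ k h x y, p k h y = x → le k h (s k h x) y
  /-- `t_k(x)` is the maximum of the fibre over `x`. -/
  le_t : ∀ k h x y, p k h y = x → le k h y (t k h x)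

namespace Disk

/-- Maps of `n`-disks: families of maps commuting with `s`, `t`, `p` and preserving the linear
orders of the fibres. -/
@[ext]
structure Hom {n : ℕ} (D E : Disk.{u} n) : Type u where
  /-- the maps `f_k` -/
  app : (k : ℕ) → (h : k ≤ n) → D.X k h → E.X k h
  app_s : ∀ k h x, app (k + 1) h (D.s k h x) = E.s k h (app k (Nat.le_of_succ_le h) x)
  app_t : ∀ k h x, app (k + 1) h (D.t k h x) = E.t k h (app k (Nat.le_of_succ_le h) x)
  app_p : ∀ k h y, app k (Nat.le_of_succ_le h) (D.p k h y) = E.p k h (app (k + 1) h y)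
  app_le : ∀ k h y y', D.le k h y y' → E.le k h (app (k + 1) h y) (app (k + 1) h y')

/-- Joyal's category `𝒟_n` of finite combinatorial `n`-disks, with componentwise composition. -/
instance (n : ℕ) : Category.{u} (Disk.{u} n) where
  Hom := Hom
  id D :=
    { app := fun _ _ x => x
      app_s := fun _ _ _ => rfl
      app_t := fun _ _ _ => rfl
      app_p := fun _ _ _ => rfl
      app_le := fun _ _ _ _ hy => hy }
  comp f g :=
    { app := fun k h x => g.app k h (f.app k h x)
      app_s := fun k h x => by rw [f.app_s, g.app_s]
      app_t := fun k h x => by rw [f.app_t, g.app_t]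
      app_p := fun k h y => by rw [f.app_p, g.app_p]
      app_le := fun k h y y' hy => g.app_le k h _ _ (f.app_le k h y y' hy) }

end Disk

end BergerJoyal

/-!
The equivalence is built by recursion on the dimension. The first level of an `(n + 1)`-disk is a
finite linear order with distinct end points; if it has `m` interior points, the parts of the disk
above these are `n`-disks, while above the two end points every level has exactly one point, because
there `s` and `t` agree. So an `(n + 1)`-disk is the same as a finite sequence of `n`-disks.
A map of disks sends an interior point of the first level to an end point, where nothing more has to
be specified, or to an interior point, where it amounts to a map of `n`-disks. On the first level
it is an endpoint-preserving monotone map from an interval with `l` interior points to one with `m`.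
Such maps are dual to maps `[m] → [l]` of `Δ`, and the `j`-th interior point goes to the `i`-th one
exactly when the edge `j` of `[l]` belongs to the image of the edge `i` of `[m]`. Together with the
maps of `n`-disks this is the opposite of a map of the wreath product.

Accordingly, a functor `Φ : Aᵒᵖ ⥤ Disk n` induces `suspFunctor Φ : (Δ ≀ A)ᵒᵖ ⥤ Disk (n + 1)`, which
assembles the disks labelling an object into one disk (`Disk.susp`). If `Φ` is an equivalence then
so is `suspFunctor Φ`:
* it is faithful (`suspMap_injective`), since the ranks of the images of the interior points recover
  the map of simplices (`rank_endsMap_le_iff`);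
* it is full (`suspMap_surjective`), since a monotone map of intervals has a dual
  (`homOfMonotone`) and a map of assembled disks restricts to maps of the summands
  (`Disk.restrict`);
* it is essentially surjective, since a disk is isomorphic to the one assembled from its fibres over
  the interior points of the first level (`Disk.isIso_assemble`).

The recursion starts with the equivalence between the terminal category and the category of
`0`-disks, together with `Δ ≀ 1 ≌ Δ`.
-/

namespace BergerJoyal

/-! ### Adjoining two end points to a finite family of sets -/

/-- The disjoint union of the sets `Y i`, `i : Fin m`, with two further points `bot` and `top`,
thought of as lying before and after all the `Y i`. -/
inductive Ends {m : ℕ} (Y : Fin m → Type u) : Type u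
  | bot : Ends Y
  | mid (i : Fin m) (y : Y i) : Ends Y
  | top : Ends Y

namespace Ends

variable {m : ℕ} {Y Z : Fin m → Type u}

/-- The position of a point in the linearly ordered family `bot, Y 0, …, Y (m - 1), top`. -/
def rank : Ends Y → ℕ
  | bot => 0
  | mid i _ => i + 1
  | top => m + 1

@[simp] theorem rank_bot : rank (bot : Ends Y) = 0 := rfl
@[simp] theorem rank_mid (i : Fin m) (y : Y i) : rank (mid i y) = i + 1 := rfl
@[simp] theorem rank_top : rank (top : Ends Y) = m + 1 := rfl

theorem eq_bot_of_rank {x : Ends Y} (h : x.rank = 0) : x = bot := by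
  cases x <;> simp_all

theorem eq_top_of_rank {x : Ends Y} (h : x.rank = m + 1) : x = top := by
  cases x with
  | bot => simp at h
  | mid i y => have := i.isLt; simp only [rank_mid] at h; omega
  | top => rfl

theorem exists_mid_of_rank {x : Ends Y} {i : Fin m} (h : x.rank = i + 1) :
    ∃ y, x = mid i y := by
  cases x with
  | bot => simp at h
  | mid j y =>
    obtain rfl : j = i := Fin.ext (by simpa using h)
    exact ⟨y, rfl⟩
  | top => have := i.isLt; simp only [rank_top] at h; omega

theorem rank_le (x : Ends Y) : x.rank ≤ m + 1 := by
  cases x with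
  | bot => simp
  | mid i y => have := i.isLt; simp only [rank_mid]; omega
  | top => simp

theorem eq_of_rank_eq [∀ i, Subsingleton (Y i)] {x y : Ends Y} (h : x.rank = y.rank) : x = y := by
  cases y with
  | bot => exact eq_bot_of_rank h
  | mid i z =>
    obtain ⟨z', rfl⟩ := exists_mid_of_rank h
    rw [Subsingleton.elim z' z]
  | top => exact eq_top_of_rank h

theorem mid_injective (i : Fin m) : Function.Injective (mid (Y := Y) i) := by
  intro y y' h
  cases h
  rfl

instance [∀ i, Subsingleton (Y i)] : Finite (Ends Y) :=
  Finite.of_injective (fun x : Ends Y => (⟨x.rank, Nat.lt_succ_of_le x.rank_le⟩ : Fin (m + 2)))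
    fun _ _ h => eq_of_rank_eq (Fin.mk.inj_iff.1 h)

/-- The map induced by a family of maps, fixing the two end points. -/
def map (f : ∀ i, Y i → Z i) : Ends Y → Ends Z
  | bot => bot
  | mid i y => mid i (f i y)
  | top => top

@[simp] theorem map_bot (f : ∀ i, Y i → Z i) : map f bot = bot := rfl
@[simp] theorem map_mid (f : ∀ i, Y i → Z i) (i : Fin m) (y : Y i) :
    map f (mid i y) = mid i (f i y) := rfl
@[simp] theorem map_top (f : ∀ i, Y i → Z i) : map f top = top := rfl

@[simp] theorem rank_map (f : ∀ i, Y i → Z i) (x : Ends Y) : (map f x).rank = x.rank := by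
  cases x <;> rfl

/-- The relation induced by relations on the `Y i`; each end point is related only to itself. -/
inductive Rel (r : ∀ i, Y i → Y i → Prop) : Ends Y → Ends Y → Prop
  | bot : Rel r bot bot
  | mid {i : Fin m} {y y' : Y i} (h : r i y y') : Rel r (mid i y) (mid i y')
  | top : Rel r top top

theorem rel_mid {r : ∀ i, Y i → Y i → Prop} {i : Fin m} {y y' : Y i} :
    Rel r (.mid i y) (.mid i y') ↔ r i y y' :=
  ⟨fun h => by cases h; assumption, .mid⟩

end Ends

namespace Disk

noncomputable instance uniqueZero {n : ℕ} (D : Disk.{u} n) (h : 0 ≤ n) : Unique (D.X 0 h) where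
  default := D.existsUnique_zero.choose
  uniq _ := D.existsUnique_zero.unique rfl rfl

@[simp] theorem id_app {n : ℕ} (D : Disk.{u} n) (k : ℕ) (h : k ≤ n) (x : D.X k h) :
    Hom.app (𝟙 D) k h x = x := rfl

@[simp] theorem comp_app {n : ℕ} {D E F : Disk.{u} n} (f : D ⟶ E) (g : E ⟶ F) (k : ℕ) (h : k ≤ n)
    (x : D.X k h) : Hom.app (f ≫ g) k h x = Hom.app g k h (Hom.app f k h x) := rfl

/-! ### The disk assembled from a finite family of disks -/

section Susp

variable {n m : ℕ} (D : Fin m → Disk.{u} n)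

/-- The sets underlying `susp D`. -/
def SuspX : (k : ℕ) → k ≤ n + 1 → Type u
  | 0, _ => PUnit
  | k + 1, h => Ends fun i => (D i).X k (Nat.le_of_succ_le_succ h)

/-- The `(n + 1)`-disk assembled from `n`-disks `D 0, …, D (m - 1)`: the interior points of its
first level are indexed by `Fin m`, and the part of the disk above the `i`-th one is `D i`. -/
def susp : Disk.{u} (n + 1) where
  X := SuspX D
  s
    | 0, _, _ => Ends.bot
    | k + 1, h, x => Ends.map (fun i => (D i).s k (Nat.le_of_succ_le_succ h)) x
  t
    | 0, _, _ => Ends.top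
    | k + 1, h, x => Ends.map (fun i => (D i).t k (Nat.le_of_succ_le_succ h)) x
  p
    | 0, _, _ => PUnit.unit
    | k + 1, h, x => Ends.map (fun i => (D i).p k (Nat.le_of_succ_le_succ h)) x
  le
    | 0, _, x, y => Ends.rank x ≤ Ends.rank y
    | k + 1, h, x, y => Ends.Rel (fun i => (D i).le k (Nat.le_of_succ_le_succ h)) x y
  p_s
    | 0, _, _ => rfl
    | k + 1, h, x => by
      cases x with
      | bot => rfl
      | mid i x => exact congrArg (Ends.mid i) ((D i).p_s k _ x)
      | top => rfl
  p_t
    | 0, _, _ => rfl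
    | k + 1, h, x => by
      cases x with
      | bot => rfl
      | mid i x => exact congrArg (Ends.mid i) ((D i).p_t k _ x)
      | top => rfl
  s_s
    | 0, _, _ => rfl
    | k + 1, h, x => by
      cases x with
      | bot => rfl
      | mid i x => exact congrArg (Ends.mid i) ((D i).s_s k _ x)
      | top => rfl
  s_t
    | 0, _, _ => rfl
    | k + 1, h, x => by
      cases x with
      | bot => rfl
      | mid i x => exact congrArg (Ends.mid i) ((D i).s_t k _ x)
      | top => rfl
  existsUnique_zero := ⟨PUnit.unit, rfl, fun _ _ => rfl⟩
  s_ne_t _ _ h := by cases h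
  equalizer_eq
    | 0, h => by
      ext x
      cases x with
      | bot => exact iff_of_true rfl (Or.inl ⟨PUnit.unit, rfl⟩)
      | mid i x =>
        refine iff_of_false (fun hx => ?_) ?_
        · exact (D i).s_ne_t (Nat.le_of_succ_le_succ h) x (Ends.mid_injective i hx)
        · rintro (⟨_, hx⟩ | ⟨_, hx⟩) <;> cases hx
      | top => exact iff_of_true rfl (Or.inr ⟨PUnit.unit, rfl⟩)
    | k + 1, h => by
      ext x
      cases x with
      | bot => exact iff_of_true rfl (Or.inl ⟨Ends.bot, rfl⟩)
      | mid i x =>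
        have key := Set.ext_iff.1 ((D i).equalizer_eq k (Nat.le_of_succ_le_succ h)) x
        constructor
        · intro hx
          rcases key.1 (Ends.mid_injective i hx) with ⟨y, hy⟩ | ⟨y, hy⟩
          · exact Or.inl ⟨Ends.mid i y, congrArg (Ends.mid i) hy⟩
          · exact Or.inr ⟨Ends.mid i y, congrArg (Ends.mid i) hy⟩
        · intro hx
          refine congrArg (Ends.mid i) (key.2 ?_)
          rcases hx with ⟨y, hy⟩ | ⟨y, hy⟩
          · cases y <;> cases hy
            exact Or.inl ⟨_, rfl⟩
          · cases y <;> cases hy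
            exact Or.inr ⟨_, rfl⟩
      | top => exact iff_of_true rfl (Or.inl ⟨Ends.top, rfl⟩)
  fibre_finite
    | 0, _, _ => Set.toFinite (α := Ends fun i => (D i).X 0 (Nat.zero_le n)) _
    | k + 1, h, x => by
      cases x with
      | bot =>
        refine (Set.finite_singleton (Ends.bot : Ends _)).subset fun y hy => ?_
        cases y <;> cases hy
        rfl
      | mid i x =>
        refine (((D i).fibre_finite k (Nat.le_of_succ_le_succ h) x).image (Ends.mid i)).subset
          fun y hy => ?_
        cases y <;> cases hy
        exact ⟨_, rfl, rfl⟩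
      | top =>
        refine (Set.finite_singleton (Ends.top : Ends _)).subset fun y hy => ?_
        cases y <;> cases hy
        rfl
  p_eq_of_le
    | 0, _, _, _, _ => rfl
    | k + 1, h, _, _, hxy => by
      cases hxy with
      | bot => rfl
      | mid hxy => exact congrArg (Ends.mid _) ((D _).p_eq_of_le k _ _ _ hxy)
      | top => rfl
  le_refl
    | 0, _, _ => Nat.le_refl _
    | k + 1, h, x => by
      cases x with
      | bot => exact .bot
      | mid i x => exact .mid ((D i).le_refl k _ x)
      | top => exact .top
  le_trans
    | 0, _, _, _, _, h, h' => Nat.le_trans h h'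
    | k + 1, h, _, _, _, hxy, hyz => by
      cases hxy with
      | bot => exact hyz
      | mid hxy =>
        cases hyz with
        | mid hyz => exact .mid ((D _).le_trans k _ _ _ _ hxy hyz)
      | top => exact hyz
  le_antisymm
    | 0, _, _, _, h, h' => Ends.eq_of_rank_eq (Nat.le_antisymm h h')
    | k + 1, h, _, _, hxy, hyx => by
      cases hxy with
      | bot => rfl
      | mid hxy =>
        exact congrArg (Ends.mid _) ((D _).le_antisymm k _ _ _ hxy (Ends.rel_mid.1 hyx))
      | top => rfl
  le_total
    | 0, _, _, _, _ => Nat.le_total _ _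
    | k + 1, h, x, y, hxy => by
      cases x <;> cases y <;> try cases hxy
      · exact Or.inl .bot
      · rename_i i x j y
        obtain ⟨rfl, hxy⟩ := Ends.mid.inj hxy
        exact ((D i).le_total k _ x y (eq_of_heq hxy)).imp .mid .mid
      · exact Or.inl .top
  s_le
    | 0, _, _, _, _ => Nat.zero_le _
    | k + 1, h, _, y, hy => by
      subst hy
      cases y with
      | bot => exact .bot
      | mid i y => exact .mid ((D i).s_le k _ _ y rfl)
      | top => exact .top
  le_t
    | 0, _, _, y, _ => Ends.rank_le y
    | k + 1, h, _, y, hy => by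
      subst hy
      cases y with
      | bot => exact .bot
      | mid i y => exact .mid ((D i).le_t k _ _ y rfl)
      | top => exact .top

end Susp

end Disk

/-! ### Cuts and edges -/

section Cuts

variable {x y : SimplexCategory}

/-- The edge `j` of `y` is one of those that make up the image under `f` of the edge `i` of `x`. -/
def Covers (f : x ⟶ y) (i : Fin x.len) (j : Fin y.len) : Prop :=
  (f.toOrderHom i.castSucc : ℕ) ≤ j ∧ (j : ℕ) < f.toOrderHom i.succ

theorem mem_segalMap (f : x ⟶ y) (i : Fin x.len) (j : Fin y.len) :
    j ∈ Gam.Hom.fn (segalMap.map f) i ↔ Covers f i j := by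
  change (_ ≤ j.castSucc ∧ j.succ ≤ _) ↔ (_ ≤ _ ∧ _ < _)
  simp only [Fin.le_def, Fin.val_castSucc, Fin.val_succ, Nat.succ_le_iff]

theorem Covers.eq {f : x ⟶ y} {i i' : Fin x.len} {j : Fin y.len} (h : Covers f i j)
    (h' : Covers f i' j) : i = i' :=
  Gam.Hom.eq_of_mem _ ((mem_segalMap f i j).2 h) ((mem_segalMap f i' j).2 h')

theorem Covers.comp {x y z : SimplexCategory} {f : x ⟶ y} {g : y ⟶ z} {i : Fin x.len}
    {j : Fin y.len} {k : Fin z.len} (h : Covers f i j) (h' : Covers g j k) :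
    Covers (f ≫ g) i k := by
  rw [← mem_segalMap, segalMap.map_comp]
  exact (Gam.mem_comp _ _).2 ⟨j, (mem_segalMap f i j).2 h, (mem_segalMap g j k).2 h'⟩

theorem covers_id (x : SimplexCategory) (i : Fin x.len) : Covers (𝟙 x) i i :=
  ⟨Nat.le_refl _, Nat.lt_succ_self _⟩

/-- The edges of `y` lie before, in or after the range covered by `f`. -/
theorem edge_trichotomy (f : x ⟶ y) (j : Fin y.len) :
    (j : ℕ) < f.toOrderHom 0 ∨ (∃ i, Covers f i j) ∨
      (f.toOrderHom (Fin.last _) : ℕ) ≤ j := by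
  by_contra! hj
  obtain ⟨h0, hmid, hlast⟩ := hj
  have key : ∀ i : Fin (x.len + 1), (f.toOrderHom i : ℕ) ≤ j := by
    intro i
    induction i using Fin.induction with
    | zero => exact h0
    | succ i ih =>
      by_contra! hlt
      exact hmid i ⟨ih, hlt⟩
  exact absurd (key (Fin.last _)) (not_le.2 hlast)

theorem toOrderHom_mono (f : x ⟶ y) {a b : Fin (x.len + 1)} (h : (a : ℕ) ≤ b) :
    (f.toOrderHom a : ℕ) ≤ f.toOrderHom b :=
  f.toOrderHom.monotone h

/-- A map of simplices is determined by which edges of the target lie before each image vertex. -/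
theorem hom_ext_of_lt_iff {f g : x ⟶ y}
    (h : ∀ (i : Fin (x.len + 1)) (j : Fin y.len),
      (j : ℕ) < f.toOrderHom i ↔ (j : ℕ) < g.toOrderHom i) : f = g := by
  apply SimplexCategory.Hom.ext
  apply OrderHom.ext
  funext i
  apply Fin.ext
  have hf := (f.toOrderHom i).isLt
  have hg := (g.toOrderHom i).isLt
  rcases lt_trichotomy (f.toOrderHom i : ℕ) (g.toOrderHom i) with hlt | heq | hlt
  · exact absurd ((h i ⟨f.toOrderHom i, by omega⟩).2 hlt) (lt_irrefl _)
  · exact heq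
  · exact absurd ((h i ⟨g.toOrderHom i, by omega⟩).1 hlt) (lt_irrefl _)

/-- The elements below a threshold of a monotone function on `Fin l` form an initial segment. -/
theorem lt_card_filter_iff {l : ℕ} {c : Fin l → ℕ} (hc : Monotone c) (i : ℕ) (j : Fin l) :
    (j : ℕ) < (Finset.univ.filter fun j => c j ≤ i).card ↔ c j ≤ i := by
  constructor
  · intro hj
    by_contra! hlt
    have hsub : (Finset.univ.filter fun j => c j ≤ i) ⊆ Finset.Iio j := by
      intro j' hj'
      rw [Finset.mem_filter] at hj'
      rw [Finset.mem_Iio]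
      by_contra! hle
      exact absurd (hc hle) (by omega)
    have := Finset.card_le_card hsub
    rw [Fin.card_Iio] at this
    omega
  · intro hj
    have hsub : Finset.Iic j ⊆ (Finset.univ.filter fun j => c j ≤ i) := by
      intro j' hj'
      rw [Finset.mem_Iic] at hj'
      rw [Finset.mem_filter]
      exact ⟨Finset.mem_univ _, (hc hj').trans hj⟩
    have := Finset.card_le_card hsub
    rw [Fin.card_Iic] at this
    omega

/-- The map of simplices dual to a monotone function `c` from the edges of `y` to positions: it
carries a vertex `i` to the number of edges `j` with `c j ≤ i`. -/
def homOfMonotone {c : Fin y.len → ℕ} (_ : Monotone c) : x ⟶ y :=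
  SimplexCategory.Hom.mk
    { toFun := fun i => ⟨(Finset.univ.filter fun j => c j ≤ i).card, by
        have := Finset.card_filter_le (Finset.univ : Finset (Fin y.len)) fun j => c j ≤ i
        rw [Finset.card_univ, Fintype.card_fin] at this
        omega⟩
      monotone' := fun i i' hi => by
        refine Fin.mk_le_mk.2 (Finset.card_le_card fun j hj => ?_)
        rw [Finset.mem_filter] at hj ⊢
        exact ⟨hj.1, hj.2.trans hi⟩ }

theorem lt_homOfMonotone_iff {c : Fin y.len → ℕ} (hc : Monotone c) (i : Fin (x.len + 1))
    (j : Fin y.len) : (j : ℕ) < (homOfMonotone (x := x) hc).toOrderHom i ↔ c j ≤ i :=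
  lt_card_filter_iff hc i j

end Cuts

/-! ### Maps between assembled disks -/

section SuspMap

variable {x y : SimplexCategory} {Y Z : Fin x.len → Type u} {Y' Z' : Fin y.len → Type u}

open Classical in
/-- The map of families with end points dual to a map of simplices `f₀` together with maps
`Y' j → Y i` for each edge `j` of `y` covered by the image of the edge `i` of `x`. The sets over the
edges before and after the range of `f₀` are sent to the end points. -/
noncomputable def endsMap (f₀ : x ⟶ y)
    (φ : ∀ i j, Covers f₀ i j → Y' j → Y i) : Ends Y' → Ends Y
  | .bot => .bot
  | .mid j a =>
    if h : ∃ i, Covers f₀ i j then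
      .mid h.choose (φ h.choose j h.choose_spec a)
    else if (j : ℕ) < f₀.toOrderHom 0 then .bot else .top
  | .top => .top

variable (f₀ : x ⟶ y) (φ : ∀ i j, Covers f₀ i j → Y' j → Y i)

@[simp] theorem endsMap_bot : endsMap f₀ φ .bot = .bot := rfl

@[simp] theorem endsMap_top : endsMap f₀ φ .top = .top := rfl

theorem endsMap_mid_of_covers {i : Fin x.len} {j : Fin y.len}
    (h : Covers f₀ i j) (a : Y' j) :
    endsMap f₀ φ (.mid j a) = .mid i (φ i j h a) := by
  have h' : ∃ i, Covers f₀ i j := ⟨i, h⟩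
  have key : ∀ (i' : Fin x.len) (hi' : Covers f₀ i' j),
      (Ends.mid i' (φ i' j hi' a) : Ends Y) = .mid i (φ i j h a) := by
    intro i' hi'
    obtain rfl : i' = i := hi'.eq h
    rfl
  rw [endsMap, dif_pos h']
  exact key _ _

theorem endsMap_mid_of_lt {j : Fin y.len} (h : (j : ℕ) < f₀.toOrderHom 0) (a : Y' j) :
    endsMap f₀ φ (.mid j a) = .bot := by
  have h' : ¬ ∃ i, Covers f₀ i j := by
    rintro ⟨i, hi⟩
    have h1 := hi.1
    have h2 := toOrderHom_mono f₀ (a := 0) (b := i.castSucc) (Nat.zero_le _)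
    omega
  rw [endsMap, dif_neg h', if_pos h]

theorem endsMap_mid_of_le {j : Fin y.len} (h : (f₀.toOrderHom (Fin.last _) : ℕ) ≤ j) (a : Y' j) :
    endsMap f₀ φ (.mid j a) = .top := by
  have h' : ¬ ∃ i, Covers f₀ i j := by
    rintro ⟨i, hi⟩
    have h1 := hi.2
    have h2 := toOrderHom_mono f₀ (a := i.succ) (b := Fin.last _) (Fin.le_last _)
    omega
  have h'' : ¬ (j : ℕ) < f₀.toOrderHom 0 := by
    have h2 := toOrderHom_mono f₀ (a := 0) (b := Fin.last _) (Nat.zero_le _)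
    omega
  rw [endsMap, dif_neg h', if_neg h'']

/-- The rank of the image of a point over the edge `j` is the number of the first vertex of `x` that
`f₀` sends beyond `j`, or `x.len + 1` if there is none. -/
theorem rank_endsMap_le_iff (i : Fin (x.len + 1)) (j : Fin y.len) (a : Y' j) :
    (endsMap f₀ φ (.mid j a)).rank ≤ i ↔ (j : ℕ) < f₀.toOrderHom i := by
  rcases edge_trichotomy f₀ j with h | ⟨i', h⟩ | h
  · rw [endsMap_mid_of_lt f₀ φ h]
    have h2 := toOrderHom_mono f₀ (a := 0) (b := i) (Nat.zero_le _)
    simp only [Ends.rank_bot, Nat.zero_le, true_iff]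
    omega
  · rw [endsMap_mid_of_covers f₀ φ h, Ends.rank_mid]
    constructor
    · intro hi
      exact h.2.trans_le (toOrderHom_mono f₀ (by simpa using hi))
    · intro hj
      by_contra! hlt
      have := toOrderHom_mono f₀ (a := i) (b := i'.castSucc) (by simpa using hlt)
      exact absurd (h.1.trans_lt (hj.trans_le this)) (lt_irrefl _)
  · rw [endsMap_mid_of_le f₀ φ h, Ends.rank_top]
    have h1 := i.isLt
    have h2 := toOrderHom_mono f₀ (a := i) (b := Fin.last _) (Fin.le_last _)
    constructor <;> intro <;> omega

theorem rank_endsMap_mono {a b : Ends Y'} (h : a.rank ≤ b.rank) :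
    (endsMap f₀ φ a).rank ≤ (endsMap f₀ φ b).rank := by
  cases b with
  | bot => rw [Ends.eq_bot_of_rank (Nat.le_zero.1 h)]
  | top => exact Ends.rank_le _
  | mid j b =>
    cases a with
    | bot => exact Nat.zero_le _
    | top => have := j.isLt; simp only [Ends.rank_top, Ends.rank_mid] at h; omega
    | mid j' a =>
      simp only [Ends.rank_mid] at h
      by_contra! hlt
      -- The smaller rank is a vertex of `x`, which `f₀` sends beyond `j`, hence beyond `j'`.
      have hle := Ends.rank_le (endsMap f₀ φ (.mid j' a))
      have h1 := (rank_endsMap_le_iff f₀ φ ⟨_, hlt.trans_le hle⟩ j b).1 le_rfl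
      have h2 := (rank_endsMap_le_iff f₀ φ ⟨_, hlt.trans_le hle⟩ j' a).2 (by omega)
      exact absurd h2 (not_le.2 hlt)

/-- Naturality of `endsMap` in the two families. -/
theorem endsMap_map (φ' : ∀ i j, Covers f₀ i j → Z' j → Z i)
    (g' : ∀ j, Y' j → Z' j) (g : ∀ i, Y i → Z i)
    (h : ∀ i j hj a, φ' i j hj (g' j a) = g i (φ i j hj a)) (a : Ends Y') :
    endsMap f₀ φ' (Ends.map g' a) = Ends.map g (endsMap f₀ φ a) := by
  cases a with
  | bot => rfl
  | top => rfl
  | mid j a =>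
    rw [Ends.map_mid]
    rcases edge_trichotomy f₀ j with hj | ⟨i, hj⟩ | hj
    · rw [endsMap_mid_of_lt f₀ _ hj, endsMap_mid_of_lt f₀ _ hj, Ends.map_bot]
    · rw [endsMap_mid_of_covers f₀ _ hj, endsMap_mid_of_covers f₀ _ hj, Ends.map_mid, h]
    · rw [endsMap_mid_of_le f₀ _ hj, endsMap_mid_of_le f₀ _ hj, Ends.map_top]

theorem endsMap_rel {r' : ∀ j, Y' j → Y' j → Prop} {r : ∀ i, Y i → Y i → Prop}
    (h : ∀ i j hj a b, r' j a b → r i (φ i j hj a) (φ i j hj b)) {a b : Ends Y'}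
    (hab : Ends.Rel r' a b) : Ends.Rel r (endsMap f₀ φ a) (endsMap f₀ φ b) := by
  cases hab with
  | bot => exact .bot
  | top => exact .top
  | @mid j a b hab =>
    rcases edge_trichotomy f₀ j with hj | ⟨i, hj⟩ | hj
    · rw [endsMap_mid_of_lt f₀ _ hj, endsMap_mid_of_lt f₀ _ hj]; exact .bot
    · rw [endsMap_mid_of_covers f₀ _ hj, endsMap_mid_of_covers f₀ _ hj]
      exact .mid (h i j hj a b hab)
    · rw [endsMap_mid_of_le f₀ _ hj, endsMap_mid_of_le f₀ _ hj]; exact .top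

end SuspMap

section SuspMap

open Opposite

variable {A : Type w} [Category.{z} A]

namespace Wreath

/-- The label of an edge, with the edges of `P.base` indexed by `Fin P.base.len`. -/
def edgeLabel (P : Wreath segalMap A) (i : Fin P.base.len) : A := P.label i

/-- The component of a map of the wreath product at a pair of edges. Using `edgeLabel` and `Covers`
in place of `label` and `segalMap` keeps all indices in `Fin P.base.len`, instead of the index types
`Fin (segalMap.obj P.base).card`, which agree with them only after unfolding `segalMap`. -/
def Hom.edgeMap {P Q : Wreath segalMap A} (f : Hom P Q) (i : Fin P.base.len) (j : Fin Q.base.len)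
    (h : Covers f.base i j) : P.edgeLabel i ⟶ Q.edgeLabel j :=
  f.app i j ((mem_segalMap f.base i j).2 h)

theorem edgeMap_id (P : Wreath segalMap A) (i : Fin P.base.len) (h : Covers (Hom.base (𝟙 P)) i i) :
    Hom.edgeMap (𝟙 P) i i h = 𝟙 _ := rfl

theorem edgeMap_comp {P Q R : Wreath segalMap A} (f : P ⟶ Q) (g : Q ⟶ R) {i : Fin P.base.len}
    {j : Fin Q.base.len} {k : Fin R.base.len} (hf : Covers (Hom.base f) i j)
    (hg : Covers (Hom.base g) j k) (h : Covers (Hom.base (f ≫ g)) i k) :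
    Hom.edgeMap (f ≫ g) i k h = Hom.edgeMap f i j hf ≫ Hom.edgeMap g j k hg :=
  Hom.comp_app f g _ _ _

theorem hom_ext {P Q : Wreath segalMap A} {f g : Hom P Q} (h : f.base = g.base)
    (h' : ∀ i j (hf : Covers f.base i j) (hg : Covers g.base i j),
      f.edgeMap i j hf = g.edgeMap i j hg) : f = g :=
  Hom.ext' h fun i j hf hg =>
    h' i j ((mem_segalMap f.base i j).1 hf) ((mem_segalMap g.base i j).1 hg)

end Wreath

variable {n : ℕ} (Φ : Aᵒᵖ ⥤ Disk.{u} n)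

/-- The disk assembled from the images under `Φ` of the labels of `P`. -/
def suspObj (P : Wreath segalMap A) : Disk.{u} (n + 1) :=
  Disk.susp fun i => Φ.obj (op (P.edgeLabel i))

/-- The level `k + 1` of `suspMap`. -/
noncomputable def suspMapApp {P Q : Wreath segalMap A} (f : Wreath.Hom P Q) (k : ℕ) (h : k ≤ n) :
    Ends (fun j => (Φ.obj (op (Q.edgeLabel j))).X k h) →
      Ends (fun i => (Φ.obj (op (P.edgeLabel i))).X k h) :=
  endsMap f.base fun i j hj => Disk.Hom.app (Φ.map (f.edgeMap i j hj).op) k h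

/-- The map of assembled disks induced by a map of the wreath product. -/
noncomputable def suspMap {P Q : Wreath segalMap A} (f : Wreath.Hom P Q) :
    suspObj Φ Q ⟶ suspObj Φ P where
  app
    | 0, _ => fun _ => PUnit.unit
    | k + 1, h => suspMapApp Φ f k (Nat.le_of_succ_le_succ h)
  app_s
    | 0, _, _ => rfl
    | k + 1, _, a => endsMap_map f.base
        (fun i j hj => Disk.Hom.app (Φ.map (f.edgeMap i j hj).op) k _)
        (fun i j hj => Disk.Hom.app (Φ.map (f.edgeMap i j hj).op) (k + 1) _) _ _
        (fun _ _ _ => Disk.Hom.app_s _ k _) a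
  app_t
    | 0, _, _ => rfl
    | k + 1, _, a => endsMap_map f.base
        (fun i j hj => Disk.Hom.app (Φ.map (f.edgeMap i j hj).op) k _)
        (fun i j hj => Disk.Hom.app (Φ.map (f.edgeMap i j hj).op) (k + 1) _) _ _
        (fun _ _ _ => Disk.Hom.app_t _ k _) a
  app_p
    | 0, _, _ => rfl
    | k + 1, h, a => endsMap_map f.base
        (fun i j hj => Disk.Hom.app (Φ.map (f.edgeMap i j hj).op) (k + 1) _)
        (fun i j hj => Disk.Hom.app (Φ.map (f.edgeMap i j hj).op) k _)
        (fun j => (Φ.obj (op (Q.edgeLabel j))).p k (Nat.le_of_succ_le_succ h))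
        (fun i => (Φ.obj (op (P.edgeLabel i))).p k (Nat.le_of_succ_le_succ h))
        (fun _ _ _ b => Disk.Hom.app_p _ k _ b) a
  app_le
    | 0, _, _, _, hab => rank_endsMap_mono f.base
        (fun i j hj => Disk.Hom.app (Φ.map (f.edgeMap i j hj).op) 0 _) hab
    | k + 1, _, _, _, hab => endsMap_rel f.base
        (fun i j hj => Disk.Hom.app (Φ.map (f.edgeMap i j hj).op) (k + 1) _)
        (fun _ _ _ => Disk.Hom.app_le _ k _) hab

theorem suspMapApp_mid {P Q : Wreath segalMap A} (f : Wreath.Hom P Q) (k : ℕ) (h : k ≤ n)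
    {i : Fin P.base.len} {j : Fin Q.base.len} (hij : Covers f.base i j)
    (a : (Φ.obj (op (Q.edgeLabel j))).X k h) :
    suspMapApp Φ f k h (.mid j a) = .mid i (Disk.Hom.app (Φ.map (f.edgeMap i j hij).op) k h a) :=
  endsMap_mid_of_covers (Y' := fun j => (Φ.obj (op (Q.edgeLabel j))).X k h) f.base
    (fun i j hj => Disk.Hom.app (Φ.map (f.edgeMap i j hj).op) k h) hij a

theorem suspMapApp_id (P : Wreath segalMap A) (k : ℕ) (h : k ≤ n) (a) :
    suspMapApp Φ (𝟙 P) k h a = a := by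
  cases a with
  | bot => rfl
  | top => rfl
  | mid i a =>
    have hi : Covers (Wreath.Hom.base (𝟙 P)) i i := covers_id P.base i
    refine (suspMapApp_mid Φ (𝟙 P) k h hi a).trans (congrArg (Ends.mid i) ?_)
    rw [Wreath.edgeMap_id, op_id, Φ.map_id]
    rfl

theorem suspMapApp_comp {P Q R : Wreath segalMap A} (f : P ⟶ Q) (g : Q ⟶ R) (k : ℕ) (h : k ≤ n)
    (a) : suspMapApp Φ (f ≫ g) k h a = suspMapApp Φ f k h (suspMapApp Φ g k h a) := by
  cases a with
  | bot => rfl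
  | top => rfl
  | mid l a =>
    have hcomp : ∀ i, (Wreath.Hom.base (f ≫ g)).toOrderHom i =
      (Wreath.Hom.base g).toOrderHom ((Wreath.Hom.base f).toOrderHom i) := fun _ => rfl
    unfold suspMapApp
    rcases edge_trichotomy (Wreath.Hom.base g) l with hl | ⟨j, hl⟩ | hl
    · rw [endsMap_mid_of_lt _ _ hl, endsMap_bot]
      refine endsMap_mid_of_lt _ _ ?_ _
      rw [hcomp]
      exact hl.trans_le (toOrderHom_mono _ (Nat.zero_le _))
    · rw [endsMap_mid_of_covers _ _ hl]
      rcases edge_trichotomy (Wreath.Hom.base f) j with hj | ⟨i, hj⟩ | hj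
      · rw [endsMap_mid_of_lt _ _ hj]
        refine endsMap_mid_of_lt _ _ ?_ _
        rw [hcomp]
        exact hl.2.trans_le (toOrderHom_mono _ hj)
      · rw [endsMap_mid_of_covers _ _ hj]
        have hi : Covers (Wreath.Hom.base (f ≫ g)) i l := hj.comp hl
        refine (suspMapApp_mid Φ (f ≫ g) k h hi a).trans (congrArg (Ends.mid i) ?_)
        rw [Wreath.edgeMap_comp f g hj hl, op_comp, Φ.map_comp]
        rfl
      · rw [endsMap_mid_of_le _ _ hj]
        refine endsMap_mid_of_le _ _ ?_ _
        rw [hcomp]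
        exact (toOrderHom_mono _ hj).trans hl.1
    · rw [endsMap_mid_of_le _ _ hl, endsMap_top]
      refine endsMap_mid_of_le _ _ ?_ _
      rw [hcomp]
      exact (toOrderHom_mono _ (Fin.le_last _)).trans hl

theorem suspMap_ext {P Q : Wreath segalMap A} {f g : suspObj Φ Q ⟶ suspObj Φ P}
    (h : ∀ k (hk : k ≤ n) a, Disk.Hom.app f (k + 1) (Nat.succ_le_succ hk) a =
      Disk.Hom.app g (k + 1) (Nat.succ_le_succ hk) a) : f = g := by
  apply Disk.Hom.ext
  funext k hk a
  cases k with
  | zero => rfl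
  | succ k => exact h k (Nat.le_of_succ_le_succ hk) a

/-- The functor `(Δ ≀ A)ᵒᵖ ⥤ 𝒟_{n+1}` induced by a functor `Φ : Aᵒᵖ ⥤ 𝒟_n`. -/
noncomputable def suspFunctor : (Wreath segalMap A)ᵒᵖ ⥤ Disk.{u} (n + 1) where
  obj P := suspObj Φ P.unop
  map f := suspMap Φ f.unop
  map_id P := suspMap_ext Φ fun k hk => suspMapApp_id Φ P.unop k hk
  map_comp f g := suspMap_ext Φ fun k hk => suspMapApp_comp Φ g.unop f.unop k hk

theorem suspMap_injective [Φ.Faithful] {P Q : Wreath segalMap A} {f g : P ⟶ Q}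
    (h : suspMap Φ f = suspMap Φ g) : f = g := by
  have happ : ∀ k (hk : k ≤ n) a, suspMapApp Φ f k hk a = suspMapApp Φ g k hk a := fun k hk a =>
    congrFun (congrFun (congrFun (congrArg Disk.Hom.app h) (k + 1)) (Nat.succ_le_succ hk)) a
  refine Wreath.hom_ext (hom_ext_of_lt_iff fun i j => ?_) fun i j hf hg => ?_
  · rw [← rank_endsMap_le_iff _ (fun i j hj => Disk.Hom.app (Φ.map (Wreath.Hom.edgeMap f i j hj).op)
      0 (Nat.zero_le n)) i j default, ← rank_endsMap_le_iff _ (fun i j hj =>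
      Disk.Hom.app (Φ.map (Wreath.Hom.edgeMap g i j hj).op) 0 (Nat.zero_le n)) i j default]
    exact iff_of_eq (congrArg (fun e => Ends.rank e ≤ i) (happ 0 (Nat.zero_le n) (.mid j default)))
  · refine Quiver.Hom.op_inj (Φ.map_injective (Disk.Hom.ext ?_))
    funext k hk a
    have := happ k hk (.mid j a)
    rw [suspMapApp_mid Φ f k hk hf, suspMapApp_mid Φ g k hk hg] at this
    exact Ends.mid_injective i this

instance [Φ.Faithful] : (suspFunctor Φ).Faithful where
  map_injective h := Quiver.Hom.unop_inj (suspMap_injective Φ h)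

end SuspMap

/-! ### Every map between assembled disks comes from the wreath product -/

namespace Disk

section SuspHom

variable {n m l : ℕ} {D : Fin m → Disk.{u} n} {E : Fin l → Disk.{u} n} (g : susp E ⟶ susp D)

/-- The component in degree `k + 1` of a map of assembled disks. -/
def suspLevel (k : ℕ) (h : k ≤ n) :
    Ends (fun j => (E j).X k h) → Ends (fun i => (D i).X k h) :=
  Hom.app g (k + 1) (Nat.succ_le_succ h)

theorem suspLevel_s (k : ℕ) (h : k + 1 ≤ n) (a : Ends fun j => (E j).X k (Nat.le_of_succ_le h)) :
    suspLevel g (k + 1) h (a.map fun j => (E j).s k h) =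
      (suspLevel g k (Nat.le_of_succ_le h) a).map fun i => (D i).s k h :=
  Hom.app_s g (k + 1) (Nat.succ_le_succ h) a

theorem suspLevel_t (k : ℕ) (h : k + 1 ≤ n) (a : Ends fun j => (E j).X k (Nat.le_of_succ_le h)) :
    suspLevel g (k + 1) h (a.map fun j => (E j).t k h) =
      (suspLevel g k (Nat.le_of_succ_le h) a).map fun i => (D i).t k h :=
  Hom.app_t g (k + 1) (Nat.succ_le_succ h) a

theorem suspLevel_p (k : ℕ) (h : k + 1 ≤ n) (a : Ends fun j => (E j).X (k + 1) h) :
    suspLevel g k (Nat.le_of_succ_le h) (a.map fun j => (E j).p k h) =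
      (suspLevel g (k + 1) h a).map fun i => (D i).p k h :=
  Hom.app_p g (k + 1) (Nat.succ_le_succ h) a

theorem suspLevel_rel (k : ℕ) (h : k + 1 ≤ n) {a b : Ends fun j => (E j).X (k + 1) h}
    (hab : Ends.Rel (fun j => (E j).le k h) a b) :
    Ends.Rel (fun i => (D i).le k h) (suspLevel g (k + 1) h a) (suspLevel g (k + 1) h b) :=
  Hom.app_le g (k + 1) (Nat.succ_le_succ h) a b hab

theorem suspLevel_rank_mono (h : 0 ≤ n) {a b : Ends fun j => (E j).X 0 h}
    (hab : a.rank ≤ b.rank) : (suspLevel g 0 h a).rank ≤ (suspLevel g 0 h b).rank :=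
  Hom.app_le g 0 (Nat.succ_le_succ h) a b hab

theorem suspLevel_bot (k : ℕ) (h : k ≤ n) : suspLevel g k h .bot = .bot := by
  induction k with
  | zero => exact Hom.app_s g 0 (Nat.succ_le_succ h) PUnit.unit
  | succ k ih =>
    have := suspLevel_s g k h .bot
    rwa [ih, Ends.map_bot, Ends.map_bot] at this

theorem suspLevel_top (k : ℕ) (h : k ≤ n) : suspLevel g k h .top = .top := by
  induction k with
  | zero => exact Hom.app_t g 0 (Nat.succ_le_succ h) PUnit.unit
  | succ k ih =>
    have := suspLevel_t g k h .top
    rwa [ih, Ends.map_top, Ends.map_top] at this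

/-- The position in the first level of `susp D` to which the `j`-th interior point of the first
level of `susp E` is mapped. -/
noncomputable def suspRank (j : Fin l) : ℕ := (suspLevel g 0 (Nat.zero_le n) (.mid j default)).rank

theorem suspRank_mono : Monotone (suspRank g) := fun _ _ hj =>
  suspLevel_rank_mono g _ (Nat.succ_le_succ hj)

/-- The points above the `j`-th interior point are all mapped into the same summand. -/
theorem rank_suspLevel (k : ℕ) (h : k ≤ n) (j : Fin l) (a : (E j).X k h) :
    (suspLevel g k h (.mid j a)).rank = suspRank g j := by
  induction k with
  | zero => rw [Subsingleton.elim a default]; rfl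
  | succ k ih =>
    have := congrArg Ends.rank (suspLevel_p g k h (.mid j a))
    rw [Ends.rank_map, Ends.map_mid, ih] at this
    exact this.symm

variable {g}

/-- The value at `a` of the map `E j ⟶ D i` cut out of `g`. -/
noncomputable def restrictApp {i : Fin m} {j : Fin l} (hij : suspRank g j = i + 1) (k : ℕ)
    (h : k ≤ n) (a : (E j).X k h) : (D i).X k h :=
  (Ends.exists_mid_of_rank ((rank_suspLevel g k h j a).trans hij)).choose

theorem mid_restrictApp {i : Fin m} {j : Fin l} (hij : suspRank g j = i + 1) (k : ℕ)
    (h : k ≤ n) (a : (E j).X k h) :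
    suspLevel g k h (.mid j a) = .mid i (restrictApp hij k h a) :=
  (Ends.exists_mid_of_rank ((rank_suspLevel g k h j a).trans hij)).choose_spec

/-- The map `E j ⟶ D i` cut out of a map of assembled disks that carries the `j`-th interior point
of the first level to the `i`-th one. -/
noncomputable def restrict {i : Fin m} {j : Fin l} (hij : suspRank g j = i + 1) : E j ⟶ D i where
  app := restrictApp hij
  app_s k h a := by
    have := suspLevel_s g k h (.mid j a)
    rw [Ends.map_mid, mid_restrictApp hij, mid_restrictApp hij, Ends.map_mid] at this
    exact Ends.mid_injective i this
  app_t k h a := by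
    have := suspLevel_t g k h (.mid j a)
    rw [Ends.map_mid, mid_restrictApp hij, mid_restrictApp hij, Ends.map_mid] at this
    exact Ends.mid_injective i this
  app_p k h a := by
    have := suspLevel_p g k h (.mid j a)
    rw [Ends.map_mid, mid_restrictApp hij, mid_restrictApp hij, Ends.map_mid] at this
    exact Ends.mid_injective i this
  app_le k h a b hab := by
    have := suspLevel_rel g k h (Ends.Rel.mid hab)
    rw [mid_restrictApp hij, mid_restrictApp hij] at this
    exact Ends.rel_mid.1 this

end SuspHom

end Disk

section Full

open Opposite

variable {A : Type w} [Category.{z} A] {n : ℕ} (Φ : Aᵒᵖ ⥤ Disk.{u} n)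

/-- If the map of simplices dual to `g` covers the edge `j` from the edge `i`, then `g` carries the
`j`-th interior point to the `i`-th one. -/
theorem suspRank_eq_of_covers {P Q : Wreath segalMap A} (g : suspObj Φ Q ⟶ suspObj Φ P)
    {i : Fin P.base.len} {j : Fin Q.base.len}
    (h : Covers (homOfMonotone (Disk.suspRank_mono g)) i j) : Disk.suspRank g j = i + 1 := by
  have h1 := mt (lt_homOfMonotone_iff (Disk.suspRank_mono g) i.castSucc j).2 (not_lt.2 h.1)
  have h2 := (lt_homOfMonotone_iff (Disk.suspRank_mono g) i.succ j).1 h.2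
  simp only [Fin.val_castSucc, Fin.val_succ] at h1 h2
  omega

theorem suspMap_surjective [Φ.Full] {P Q : Wreath segalMap A}
    (g : suspObj Φ Q ⟶ suspObj Φ P) : ∃ f : P ⟶ Q, suspMap Φ f = g := by
  let f : Wreath.Hom P Q :=
    { base := homOfMonotone (Disk.suspRank_mono g)
      app := fun i j hij => (Φ.preimage
        (Disk.restrict (suspRank_eq_of_covers Φ g ((mem_segalMap _ i j).1 hij)))).unop }
  refine ⟨f, suspMap_ext Φ fun k hk a => ?_⟩
  change suspMapApp Φ f k hk a = Disk.suspLevel g k hk a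
  cases a with
  | bot => exact (Disk.suspLevel_bot g k hk).symm
  | top => exact (Disk.suspLevel_top g k hk).symm
  | mid j a =>
    have hrank := Disk.rank_suspLevel g k hk j a
    rcases edge_trichotomy f.base j with hj | ⟨i, hj⟩ | hj
    · refine (endsMap_mid_of_lt _ _ hj _).trans (Ends.eq_bot_of_rank ?_).symm
      rw [hrank]
      exact Nat.le_zero.1 ((lt_homOfMonotone_iff (Disk.suspRank_mono g) 0 j).1 hj)
    · have hij := suspRank_eq_of_covers Φ g hj
      have hf : Φ.map (f.edgeMap i j hj).op = Disk.restrict hij := Φ.map_preimage _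
      rw [suspMapApp_mid Φ f k hk hj, hf]
      exact (Disk.mid_restrictApp hij k hk a).symm
    · refine (endsMap_mid_of_le _ _ hj _).trans (Ends.eq_top_of_rank ?_).symm
      have hle := Ends.rank_le (Disk.suspLevel g k hk (.mid j a))
      have := mt (lt_homOfMonotone_iff (Disk.suspRank_mono g) (Fin.last _) j).2 (not_lt.2 hj)
      rw [Fin.val_last] at this
      omega

instance [Φ.Full] : (suspFunctor Φ).Full where
  map_surjective g := by
    obtain ⟨f, hf⟩ := suspMap_surjective Φ g
    exact ⟨f.op, hf⟩

end Full

/-! ### Decomposing a disk along its first level -/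

namespace Disk

section Iso

variable {n : ℕ} {D E : Disk.{u} n}

/-- A levelwise bijective map of disks is invertible: it reflects the orders of the fibres because
these are linear. -/
theorem isIso_of_bijective (f : D ⟶ E) (hf : ∀ k h, Function.Bijective (Hom.app f k h)) :
    IsIso f := by
  let e : ∀ k h, D.X k h ≃ E.X k h := fun k h => Equiv.ofBijective _ (hf k h)
  have he : ∀ k h b, Hom.app f k h ((e k h).symm b) = b := fun k h => (e k h).apply_symm_apply
  have he' : ∀ k h a, (e k h).symm (Hom.app f k h a) = a := fun k h => (e k h).symm_apply_apply
  refine ⟨⟨Hom.mk (fun k h => (e k h).symm) ?_ ?_ ?_ ?_, ?_, ?_⟩⟩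
  · intro k h b
    apply (hf _ _).injective
    rw [he, Hom.app_s, he]
  · intro k h b
    apply (hf _ _).injective
    rw [he, Hom.app_t, he]
  · intro k h b
    apply (hf _ _).injective
    rw [he, Hom.app_p, he]
  · intro k h b b' hb
    have hp : D.p k h ((e _ _).symm b) = D.p k h ((e _ _).symm b') := by
      apply (hf _ _).injective
      rw [Hom.app_p, Hom.app_p, he, he]
      exact E.p_eq_of_le k h b b' hb
    rcases D.le_total k h _ _ hp with hle | hle
    · exact hle
    · have := Hom.app_le f k h _ _ hle
      rw [he, he] at this
      rw [E.le_antisymm k h b b' hb this]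
      exact D.le_refl k h _
  · apply Hom.ext
    funext k h a
    exact he' k h a
  · apply Hom.ext
    funext k h b
    exact he k h b

theorem bijective_of_iso (e : D ≅ E) (k : ℕ) (h : k ≤ n) :
    Function.Bijective (Hom.app e.hom k h) := by
  refine Function.bijective_iff_has_inverse.2 ⟨Hom.app e.inv k h, fun a => ?_, fun a => ?_⟩
  · rw [← comp_app, e.hom_inv_id, id_app]
  · rw [← comp_app, e.inv_hom_id, id_app]

end Iso

section Fibre

variable {n : ℕ} (X : Disk.{u} (n + 1))

/-- The first level of a disk. -/
abbrev One : Type u := X.X 1 (Nat.succ_le_succ (Nat.zero_le n))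

/-- The minimum of the first level. -/
noncomputable def least : X.One := X.s 0 (Nat.succ_le_succ (Nat.zero_le n)) default

/-- The maximum of the first level. -/
noncomputable def greatest : X.One := X.t 0 (Nat.succ_le_succ (Nat.zero_le n)) default

/-- The interior points of the first level. -/
abbrev Interior : Type u := {a : X.One // a ≠ X.least ∧ a ≠ X.greatest}

/-- The iterated projection `X_{k+1} → X_1`. -/
def root : (k : ℕ) → (h : k ≤ n) → X.X (k + 1) (Nat.succ_le_succ h) → X.One
  | 0, _, x => x
  | k + 1, h, x => root k (Nat.le_of_succ_le h) (X.p (k + 1) (Nat.succ_le_succ h) x)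

theorem root_s (k : ℕ) (h : k + 1 ≤ n) (x) :
    X.root (k + 1) h (X.s (k + 1) (Nat.succ_le_succ h) x) = X.root k (Nat.le_of_succ_le h) x :=
  congrArg (X.root k _) (X.p_s _ _ x)

theorem root_t (k : ℕ) (h : k + 1 ≤ n) (x) :
    X.root (k + 1) h (X.t (k + 1) (Nat.succ_le_succ h) x) = X.root k (Nat.le_of_succ_le h) x :=
  congrArg (X.root k _) (X.p_t _ _ x)

variable {X} in
/-- The part of a disk lying above an interior point `a` of the first level, as a disk of one
dimension less. -/
def fibre (a : X.Interior) : Disk.{u} n where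
  X k h := {x : X.X (k + 1) (Nat.succ_le_succ h) // X.root k h x = a.1}
  s k h x := ⟨X.s (k + 1) (Nat.succ_le_succ h) x.1, (X.root_s k h x.1).trans x.2⟩
  t k h x := ⟨X.t (k + 1) (Nat.succ_le_succ h) x.1, (X.root_t k h x.1).trans x.2⟩
  p k h x := ⟨X.p (k + 1) (Nat.succ_le_succ h) x.1, x.2⟩
  le k h x y := X.le (k + 1) (Nat.succ_le_succ h) x.1 y.1
  p_s k h x := Subtype.ext (X.p_s _ _ x.1)
  p_t k h x := Subtype.ext (X.p_t _ _ x.1)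
  s_s k h x := Subtype.ext (X.s_s (k + 1) (Nat.succ_le_succ h) x.1)
  s_t k h x := Subtype.ext (X.s_t (k + 1) (Nat.succ_le_succ h) x.1)
  existsUnique_zero := ⟨⟨a.1, rfl⟩, rfl, fun x _ => Subtype.ext x.2⟩
  s_ne_t h x hx := by
    have hmem : x.1 ∈ {x | X.s 1 (Nat.succ_le_succ h) x = X.t 1 (Nat.succ_le_succ h) x} :=
      congrArg Subtype.val hx
    have hxa : x.1 = a.1 := x.2
    rw [X.equalizer_eq 0 (Nat.succ_le_succ h), hxa] at hmem
    rcases hmem with ⟨y, hy⟩ | ⟨y, hy⟩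
    · rw [Subsingleton.elim y default] at hy
      exact a.2.1 hy.symm
    · rw [Subsingleton.elim y default] at hy
      exact a.2.2 hy.symm
  equalizer_eq k h := by
    ext x
    have key := Set.ext_iff.1 (X.equalizer_eq (k + 1) (Nat.succ_le_succ h)) x.1
    constructor
    · intro hx
      rcases key.1 (congrArg Subtype.val hx) with ⟨y, hy⟩ | ⟨y, hy⟩
      · refine Or.inl ⟨⟨y, ?_⟩, Subtype.ext hy⟩
        rw [← X.root_s k (Nat.le_of_succ_le h), hy]
        exact x.2
      · refine Or.inr ⟨⟨y, ?_⟩, Subtype.ext hy⟩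
        rw [← X.root_t k (Nat.le_of_succ_le h), hy]
        exact x.2
    · intro hx
      refine Subtype.ext (key.2 ?_)
      rcases hx with ⟨y, hy⟩ | ⟨y, hy⟩
      · exact Or.inl ⟨y.1, congrArg Subtype.val hy⟩
      · exact Or.inr ⟨y.1, congrArg Subtype.val hy⟩
  fibre_finite k h x := by
    refine Set.Finite.subset (((X.fibre_finite (k + 1) (Nat.succ_le_succ h) x.1).preimage
      Subtype.val_injective.injOn)) fun y hy => ?_
    exact congrArg Subtype.val hy
  p_eq_of_le k h x y hxy := Subtype.ext (X.p_eq_of_le _ _ _ _ hxy)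
  le_refl k h x := X.le_refl _ _ _
  le_trans k h x y z := X.le_trans _ _ _ _ _
  le_antisymm k h x y hxy hyx := Subtype.ext (X.le_antisymm _ _ _ _ hxy hyx)
  le_total k h x y hxy := X.le_total _ _ _ _ (congrArg Subtype.val hxy)
  s_le k h x y hxy := X.s_le _ _ _ _ (congrArg Subtype.val hxy)
  le_t k h x y hxy := X.le_t _ _ _ _ (congrArg Subtype.val hxy)

theorem least_ne_greatest : X.least ≠ X.greatest := X.s_ne_t _ _

theorem least_le (x : X.One) : X.le 0 (Nat.succ_le_succ (Nat.zero_le n)) X.least x :=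
  X.s_le _ _ _ _ (Subsingleton.elim _ _)

theorem le_greatest (x : X.One) : X.le 0 (Nat.succ_le_succ (Nat.zero_le n)) x X.greatest :=
  X.le_t _ _ _ _ (Subsingleton.elim _ _)

/-- The only point of `X_{k+1}` above the minimum of the first level. -/
noncomputable def botPoint : (k : ℕ) → (h : k ≤ n) → X.X (k + 1) (Nat.succ_le_succ h)
  | 0, _ => X.least
  | k + 1, h => X.s (k + 1) (Nat.succ_le_succ h) (botPoint k (Nat.le_of_succ_le h))

/-- The only point of `X_{k+1}` above the maximum of the first level. -/
noncomputable def topPoint : (k : ℕ) → (h : k ≤ n) → X.X (k + 1) (Nat.succ_le_succ h)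
  | 0, _ => X.greatest
  | k + 1, h => X.t (k + 1) (Nat.succ_le_succ h) (topPoint k (Nat.le_of_succ_le h))

/-- `botPoint` could equally be defined with `t` in place of `s`, since these agree on the image of
`s`. -/
theorem t_botPoint (k : ℕ) (h : k + 1 ≤ n) :
    X.t (k + 1) (Nat.succ_le_succ h) (X.botPoint k (Nat.le_of_succ_le h)) =
      X.botPoint (k + 1) h := by
  cases k with
  | zero => exact (X.s_s 0 (Nat.succ_le_succ h) default).symm
  | succ k => exact (X.s_s (k + 1) (Nat.succ_le_succ h) (X.botPoint k _)).symm

theorem s_topPoint (k : ℕ) (h : k + 1 ≤ n) :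
    X.s (k + 1) (Nat.succ_le_succ h) (X.topPoint k (Nat.le_of_succ_le h)) =
      X.topPoint (k + 1) h := by
  cases k with
  | zero => exact X.s_t 0 (Nat.succ_le_succ h) default
  | succ k => exact X.s_t (k + 1) (Nat.succ_le_succ h) (X.topPoint k _)

theorem root_botPoint (k : ℕ) (h : k ≤ n) : X.root k h (X.botPoint k h) = X.least := by
  induction k with
  | zero => rfl
  | succ k ih => exact (X.root_s k h _).trans (ih _)

theorem root_topPoint (k : ℕ) (h : k ≤ n) : X.root k h (X.topPoint k h) = X.greatest := by
  induction k with
  | zero => rfl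
  | succ k ih => exact (X.root_t k h _).trans (ih _)

theorem eq_botPoint {k : ℕ} {h : k ≤ n} {x : X.X (k + 1) (Nat.succ_le_succ h)}
    (hx : X.root k h x = X.least) : x = X.botPoint k h := by
  induction k with
  | zero => exact hx
  | succ k ih =>
    have hp := ih (h := Nat.le_of_succ_le h) hx
    -- The fibre of `x` has the minimum `s (botPoint k)` and the maximum `t (botPoint k)`.
    have h1 := X.s_le _ _ _ x hp
    have h2 := X.le_t _ _ _ x hp
    rw [X.t_botPoint k h] at h2
    exact X.le_antisymm _ _ _ _ h2 h1

theorem eq_topPoint {k : ℕ} {h : k ≤ n} {x : X.X (k + 1) (Nat.succ_le_succ h)}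
    (hx : X.root k h x = X.greatest) : x = X.topPoint k h := by
  induction k with
  | zero => exact hx
  | succ k ih =>
    have hp := ih (h := Nat.le_of_succ_le h) hx
    have h1 := X.s_le _ _ _ x hp
    have h2 := X.le_t _ _ _ x hp
    rw [X.s_topPoint k h] at h1
    exact X.le_antisymm _ _ _ _ h2 h1

/-- The interior points of the first level form a finite linearly ordered set, which can be
enumerated in increasing order. -/
theorem exists_interior_enumeration : ∃ (m : ℕ) (e : Fin m → X.Interior),
    Function.Bijective e ∧
      ∀ i j, i ≤ j → X.le 0 (Nat.succ_le_succ (Nat.zero_le n)) (e i).1 (e j).1 := by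
  classical
  have hfin : Finite X.One := by
    refine Set.finite_univ_iff.1 ((X.fibre_finite 0 _ default).subset fun x _ => ?_)
    exact Subsingleton.elim _ _
  let : LinearOrder X.Interior :=
    { le := fun a b => X.le 0 (Nat.succ_le_succ (Nat.zero_le n)) a.1 b.1
      le_refl := fun a => X.le_refl _ _ _
      le_trans := fun a b c => X.le_trans _ _ _ _ _
      le_antisymm := fun a b hab hba => Subtype.ext (X.le_antisymm _ _ _ _ hab hba)
      le_total := fun a b => X.le_total _ _ _ _ (Subsingleton.elim _ _)
      toDecidableLE := Classical.decRel _ }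
  let : Fintype X.Interior := Fintype.ofFinite _
  let e : Fin (Fintype.card X.Interior) ≃o X.Interior := Fintype.orderIsoFinOfCardEq _ rfl
  exact ⟨_, e, e.bijective, fun i j hij => e.monotone hij⟩

section Assemble

variable {X} {m : ℕ} {D : Fin m → Disk.{u} n} {e : Fin m → X.Interior}

/-- The components of `assemble`. -/
noncomputable def assembleApp (φ : ∀ i, D i ⟶ fibre (e i)) (k : ℕ) (h : k ≤ n) :
    Ends (fun i => (D i).X k h) → X.X (k + 1) (Nat.succ_le_succ h)
  | .bot => X.botPoint k h
  | .mid i x => (Hom.app (φ i) k h x).1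
  | .top => X.topPoint k h

theorem root_mid (φ : ∀ i, D i ⟶ fibre (e i)) (k : ℕ) (h : k ≤ n) (i : Fin m)
    (x : (D i).X k h) : X.root k h (assembleApp φ k h (.mid i x)) = (e i).1 :=
  (Hom.app (φ i) k h x).2

/-- The map from an assembled disk to `X` given by maps to the fibres of `X` over an increasing
family of interior points. -/
noncomputable def assemble (hmono : ∀ i j, i ≤ j →
      X.le 0 (Nat.succ_le_succ (Nat.zero_le n)) (e i).1 (e j).1)
    (φ : ∀ i, D i ⟶ fibre (e i)) : susp D ⟶ X where
  app
    | 0, _ => fun _ => default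
    | k + 1, h => assembleApp φ k (Nat.le_of_succ_le_succ h)
  app_s
    | 0, _, _ => rfl
    | k + 1, h, x => by
      cases x with
      | bot => rfl
      | mid i x => exact congrArg Subtype.val (Hom.app_s (φ i) k (Nat.le_of_succ_le_succ h) x)
      | top => exact (X.s_topPoint k (Nat.le_of_succ_le_succ h)).symm
  app_t
    | 0, _, _ => rfl
    | k + 1, h, x => by
      cases x with
      | bot => exact (X.t_botPoint k (Nat.le_of_succ_le_succ h)).symm
      | mid i x => exact congrArg Subtype.val (Hom.app_t (φ i) k (Nat.le_of_succ_le_succ h) x)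
      | top => rfl
  app_p
    | 0, _, _ => Subsingleton.elim (α := X.X 0 (Nat.zero_le _)) _ _
    | k + 1, h, x => by
      cases x with
      | bot => exact (X.p_s _ _ _).symm
      | mid i x => exact congrArg Subtype.val (Hom.app_p (φ i) k (Nat.le_of_succ_le_succ h) x)
      | top => exact (X.p_t _ _ _).symm
  app_le
    | 0, _, x, y, hxy => by
      change Ends.rank x ≤ Ends.rank y at hxy
      cases x with
      | bot => exact X.least_le _
      | top =>
        rw [Ends.eq_top_of_rank (Nat.le_antisymm (Ends.rank_le y) hxy)]
        exact X.le_refl _ _ _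
      | mid i x =>
        cases y with
        | bot => simp at hxy
        | top => exact X.le_greatest _
        | mid j y =>
          have := hmono i j (by simpa using hxy)
          rwa [← root_mid φ 0 (Nat.zero_le n) i x, ← root_mid φ 0 (Nat.zero_le n) j y] at this
    | k + 1, h, _, _, hxy => by
      cases hxy with
      | bot => exact X.le_refl _ _ _
      | mid hxy => exact Hom.app_le (φ _) k (Nat.le_of_succ_le_succ h) _ _ hxy
      | top => exact X.le_refl _ _ _

theorem assembleApp_injective (hinj : Function.Injective e)
    (φ : ∀ i, D i ⟶ fibre (e i)) (k : ℕ) (h : k ≤ n)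
    (hφ : ∀ i, Function.Injective (Hom.app (φ i) k h)) :
    Function.Injective (assembleApp φ k h) := by
  intro x y hxy
  have hroot := congrArg (X.root k h) hxy
  have hbot : X.root k h (assembleApp φ k h .bot) = X.least := X.root_botPoint k h
  have htop : X.root k h (assembleApp φ k h .top) = X.greatest := X.root_topPoint k h
  cases x with
  | bot =>
    cases y with
    | bot => rfl
    | mid j y => rw [hbot, root_mid] at hroot; exact absurd hroot.symm (e j).2.1
    | top => rw [hbot, htop] at hroot; exact absurd hroot X.least_ne_greatest
  | mid i x =>
    cases y with
    | bot => rw [hbot, root_mid] at hroot; exact absurd hroot (e i).2.1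
    | mid j y =>
      rw [root_mid, root_mid] at hroot
      obtain rfl := hinj (Subtype.ext hroot)
      exact congrArg _ (hφ i (Subtype.ext hxy))
    | top => rw [htop, root_mid] at hroot; exact absurd hroot (e i).2.2
  | top =>
    cases y with
    | bot => rw [hbot, htop] at hroot; exact absurd hroot.symm X.least_ne_greatest
    | mid j y => rw [htop, root_mid] at hroot; exact absurd hroot.symm (e j).2.2
    | top => rfl

theorem assembleApp_surjective
    (hsurj : Function.Surjective e) (φ : ∀ i, D i ⟶ fibre (e i)) (k : ℕ) (h : k ≤ n)
    (hφ : ∀ i, Function.Surjective (Hom.app (φ i) k h)) :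
    Function.Surjective (assembleApp φ k h) := by
  intro y
  by_cases h1 : X.root k h y = X.least
  · exact ⟨.bot, (X.eq_botPoint h1).symm⟩
  by_cases h2 : X.root k h y = X.greatest
  · exact ⟨.top, (X.eq_topPoint h2).symm⟩
  obtain ⟨i, hi⟩ := hsurj ⟨X.root k h y, h1, h2⟩
  obtain ⟨x, hx⟩ := hφ i ⟨y, (congrArg Subtype.val hi).symm⟩
  exact ⟨.mid i x, congrArg Subtype.val hx⟩

theorem isIso_assemble (hmono : ∀ i j, i ≤ j →
      X.le 0 (Nat.succ_le_succ (Nat.zero_le n)) (e i).1 (e j).1) (hbij : Function.Bijective e)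
    (φ : ∀ i, D i ≅ fibre (e i)) :
    IsIso (assemble hmono fun i => (φ i).hom) := by
  refine isIso_of_bijective _ fun k h => ?_
  cases k with
  | zero =>
    refine ⟨fun x y _ => Subsingleton.elim (α := (susp D).X 0 h) x y, fun y => ?_⟩
    exact ⟨PUnit.unit, Subsingleton.elim (α := X.X 0 h) _ y⟩
  | succ k =>
    have h' := Nat.le_of_succ_le_succ h
    have hφ := fun i => bijective_of_iso (φ i) k h'
    exact ⟨assembleApp_injective hbij.injective _ k h' fun i => (hφ i).injective,
      assembleApp_surjective hbij.surjective _ k h' fun i => (hφ i).surjective⟩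

end Assemble

end Fibre

end Disk

section EssSurj

open Opposite

variable {A : Type w} [Category.{z} A] {n : ℕ} (Φ : Aᵒᵖ ⥤ Disk.{u} n)

instance [Φ.EssSurj] : (suspFunctor Φ).EssSurj where
  mem_essImage X := by
    obtain ⟨m, e, hbij, hmono⟩ := X.exists_interior_enumeration
    let a : Fin m → Aᵒᵖ := fun i => Φ.objPreimage (Disk.fibre (e i))
    let P : Wreath segalMap A := ⟨SimplexCategory.mk m, fun i => (a i).unop⟩
    have hiso := Disk.isIso_assemble (D := fun i => Φ.obj (a i)) hmono hbij
      fun i => Φ.objObjPreimageIso _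
    exact ⟨op P, ⟨@asIso _ _ _ _ _ hiso⟩⟩

/-- If `Φ` is an equivalence `Aᵒᵖ ≌ 𝒟_n`, then `suspFunctor Φ` is an equivalence
`(Δ ≀ A)ᵒᵖ ≌ 𝒟_{n+1}`. -/
instance [Φ.IsEquivalence] : (suspFunctor Φ).IsEquivalence where

end EssSurj

/-! ### The two families of categories -/

/-- The functor forgetting the labels, which carry no information for the terminal category. -/
def wreathForget : Wreath segalMap (Discrete PUnit.{1}) ⥤ SimplexCategory where
  obj P := P.base
  map f := Wreath.Hom.base f
  map_id _ := rfl
  map_comp _ _ := rfl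

instance : wreathForget.IsEquivalence where
  faithful := ⟨fun h => Wreath.Hom.ext' h fun _ _ _ _ => Subsingleton.elim _ _⟩
  full := ⟨fun f => ⟨⟨f, fun _ _ _ => eqToHom (Subsingleton.elim _ _)⟩, rfl⟩⟩
  essSurj := ⟨fun x => ⟨⟨x, fun _ => ⟨PUnit.unit⟩⟩, ⟨Iso.refl x⟩⟩⟩

/-- The `0`-disk. -/
def pointDisk : Disk.{u} 0 where
  X _ _ := PUnit
  s _ h := absurd h (Nat.not_succ_le_zero _)
  t _ h := absurd h (Nat.not_succ_le_zero _)
  p _ h := absurd h (Nat.not_succ_le_zero _)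
  le _ h := absurd h (Nat.not_succ_le_zero _)
  p_s _ h := absurd h (Nat.not_succ_le_zero _)
  p_t _ h := absurd h (Nat.not_succ_le_zero _)
  s_s _ h := absurd h (Nat.not_succ_le_zero _)
  s_t _ h := absurd h (Nat.not_succ_le_zero _)
  existsUnique_zero := ⟨PUnit.unit, rfl, fun _ _ => rfl⟩
  s_ne_t h := absurd h (Nat.not_succ_le_zero _)
  equalizer_eq _ h := absurd h (Nat.not_succ_le_zero _)
  fibre_finite _ h := absurd h (Nat.not_succ_le_zero _)
  p_eq_of_le _ h := absurd h (Nat.not_succ_le_zero _)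
  le_refl _ h := absurd h (Nat.not_succ_le_zero _)
  le_trans _ h := absurd h (Nat.not_succ_le_zero _)
  le_antisymm _ h := absurd h (Nat.not_succ_le_zero _)
  le_total _ h := absurd h (Nat.not_succ_le_zero _)
  s_le _ h := absurd h (Nat.not_succ_le_zero _)
  le_t _ h := absurd h (Nat.not_succ_le_zero _)

namespace Disk

/-- Between `0`-disks there is exactly one map. -/
noncomputable instance uniqueHom {D E : Disk.{u} 0} : Unique (D ⟶ E) where
  default :=
    { app := fun k h _ => by
        obtain rfl := Nat.le_zero.1 h
        exact default
      app_s := fun _ h => absurd h (Nat.not_succ_le_zero _)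
      app_t := fun _ h => absurd h (Nat.not_succ_le_zero _)
      app_p := fun _ h => absurd h (Nat.not_succ_le_zero _)
      app_le := fun _ h => absurd h (Nat.not_succ_le_zero _) }
  uniq f := by
    apply Hom.ext
    funext k h x
    obtain rfl := Nat.le_zero.1 h
    exact Subsingleton.elim _ _

end Disk

/-- The functor from the terminal category to the category of `0`-disks; both are trivial. -/
def pointFunctor : (Discrete PUnit.{1})ᵒᵖ ⥤ Disk.{u} 0 := (Functor.const _).obj pointDisk

instance : pointFunctor.{u}.IsEquivalence where
  faithful := ⟨fun _ => Quiver.Hom.unop_inj (Subsingleton.elim _ _)⟩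
  full := ⟨fun _ => ⟨eqToHom (congrArg Opposite.op (Subsingleton.elim _ _)),
    Subsingleton.elim _ _⟩⟩
  essSurj := ⟨fun _ => ⟨Opposite.op ⟨PUnit.unit⟩, ⟨⟨default, default, Subsingleton.elim _ _,
    Subsingleton.elim _ _⟩⟩⟩⟩

/-- The duality, indexed so that the recursion starts at `Θ_1 = Δ`. -/
theorem nonempty_thetaOp_equivalence_disk (n : ℕ) :
    Nonempty ((Theta (n + 1) : Type)ᵒᵖ ≌ Disk.{u} (n + 1)) := by
  induction n with
  | zero =>
    exact ⟨wreathForget.asEquivalence.op.symm.trans (suspFunctor pointFunctor).asEquivalence⟩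
  | succ n ih =>
    obtain ⟨e⟩ := ih
    exact ⟨(suspFunctor e.functor).asEquivalence⟩

end BergerJoyal

theorem theorem4p2 (n : ℕ) (hn : 1 ≤ n) :
    Nonempty ((BergerJoyal.Theta n : Type)ᵒᵖ ≌ BergerJoyal.Disk.{u} n) := by
  obtain ⟨n, rfl⟩ := Nat.exists_eq_succ_of_ne_zero (Nat.ne_of_gt hn)
  exact BergerJoyal.nonempty_thetaOp_equivalence_disk n
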